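/- Let $H$ be a complex Hilbert space (of arbitrary dimension). A bounded operator $T$ on $H$ is trace class if $\sum_i\langle e_i,|T|e_i\rangle<\infty$ for an orthonormal basis $(e_i)$ of $H$, where $|T|=(T^*T)^{1/2}$, and then $\operatorname{Tr}T=\sum_i\langle e_i,Te_i\rangle$. For positive semi-definite trace class operators $a_1,\dots,a_n$ on $H$ and $p\ge 1$ put \[ M_p(a_1,\dots,a_n)=\Bigl(\frac1n\sum_{k=1}^n a_k^{1/p}\Bigr)^p ,\qquad \mathrm{TG}(a_1,\dots,a_n)=\lim_{p\to\infty}\operatorname{Tr}M_p(a_1,\dots,a_n), \] the powers being taken by the functional calculus; $\mathrm{TG}$ is called the tracial geometric mean. Theorem (non-commutative Carleman inequality). Let $(a_n)_{n\ge1}$ be a sequence of positive semi-definite trace class operators on $H$ with $\sum_{n=1}^\infty\operatorname{Tr}a_n<\infty$. Then, for every $n\ge 1$, $M_p(a_1,\dots,a_n)$ is trace class for all $p\ge 1$ and the limit defining $\mathrm{TG}(a_1,\dots,a_n)$ exists; the series $\sum_{n=1}^\infty\mathrm{TG}(a_1,\dots,a_n)$ converges, and \[ \sum_{n=1}^\infty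 \mathrm{TG}(a_1,\dots,a_n)\le e\sum_{n=1}^\infty \operatorname{Tr}a_n . \] -/

import Mathlib

open Filter Topology
open scoped InnerProductSpace

noncomputable section

namespace TracialMean

variable {H : Type*} [NormedAddCommGroup H] [InnerProductSpace ℂ H]

theorem hasSum_sq_norm_inner {ι : Type*} (b : HilbertBasis ι ℂ H) (x : H) :
    HasSum (fun i => ‖⟪b i, x⟫_ℂ‖ ^ 2) (‖x‖ ^ 2) := by
  have h := (b.hasSum_inner_mul_inner x x).mapL Complex.reCLM
  have h2 : Complex.reCLM ⟪x, x⟫_ℂ = ‖x‖ ^ 2 := inner_self_eq_norm_sq (𝕜 := ℂ) x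
  rw [h2] at h
  refine h.congr_fun fun i => ?_
  rw [← inner_conj_symm x (b i), ← Complex.normSq_eq_conj_mul_self, Complex.reCLM_apply,
    Complex.ofReal_re, Complex.normSq_eq_norm_sq]

variable [CompleteSpace H]

/-- The trace of a positive operator does not depend on the orthonormal basis: if the diagonal sum
of `T ≥ 0` in one Hilbert basis converges to `s`, then it converges to `s` in every other one. -/
theorem hasSum_diag_of_hasSum_diag {ι κ : Type*} (b : HilbertBasis ι ℂ H)
    (c : HilbertBasis κ ℂ H) {T : H →L[ℂ] H} (hT : T.IsPositive) {s : ℝ}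
    (hs : HasSum (fun i => (⟪b i, T (b i)⟫_ℂ).re) s) :
    HasSum (fun j => (⟪c j, T (c j)⟫_ℂ).re) s := by
  have hT0 : 0 ≤ T := (ContinuousLinearMap.nonneg_iff_isPositive T).2 hT
  obtain ⟨S, hSS, hS⟩ : ∃ S : H →L[ℂ] H, S * S = T ∧ S.IsPositive :=
    ⟨CFC.sqrt T, CFC.sqrt_mul_sqrt_self T hT0,
      (ContinuousLinearMap.nonneg_iff_isPositive _).1 (CFC.sqrt_nonneg T)⟩
  have hsymm : ∀ x y : H, ⟪S x, y⟫_ℂ = ⟪x, S y⟫_ℂ := fun x y => hS.isSymmetric x y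
  have hdiag : ∀ x : H, (⟪x, T x⟫_ℂ).re = ‖S x‖ ^ 2 := by
    intro x
    rw [← hSS, mul_apply_eq_comp, ← hsymm]
    exact inner_self_eq_norm_sq (𝕜 := ℂ) (S x)
  simp only [hdiag] at hs ⊢
  have hsw : ∑' j, ENNReal.ofReal (‖S (c j)‖ ^ 2) = ∑' i, ENNReal.ofReal (‖S (b i)‖ ^ 2) := by
    have e1 : ∀ j, ENNReal.ofReal (‖S (c j)‖ ^ 2)
        = ∑' i, ENNReal.ofReal (‖⟪b i, S (c j)⟫_ℂ‖ ^ 2) := fun j => by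
      rw [← (hasSum_sq_norm_inner b (S (c j))).tsum_eq]
      exact ENNReal.ofReal_tsum_of_nonneg (fun _ => by positivity)
        (hasSum_sq_norm_inner b (S (c j))).summable
    have e2 : ∀ i, ENNReal.ofReal (‖S (b i)‖ ^ 2)
        = ∑' j, ENNReal.ofReal (‖⟪c j, S (b i)⟫_ℂ‖ ^ 2) := fun i => by
      rw [← (hasSum_sq_norm_inner c (S (b i))).tsum_eq]
      exact ENNReal.ofReal_tsum_of_nonneg (fun _ => by positivity)
        (hasSum_sq_norm_inner c (S (b i))).summable
    simp only [e1, e2]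
    rw [ENNReal.tsum_comm]
    refine tsum_congr fun i => tsum_congr fun j => ?_
    rw [← hsymm, norm_inner_symm]
  rw [← ENNReal.ofReal_tsum_of_nonneg (fun _ => by positivity) hs.summable, hs.tsum_eq] at hsw
  have hc : Summable fun j => ‖S (c j)‖ ^ 2 := by
    have h := ENNReal.summable_toReal (hsw.trans_ne ENNReal.ofReal_ne_top)
    exact h.congr fun j => ENNReal.toReal_ofReal (by positivity)
  rw [← ENNReal.ofReal_tsum_of_nonneg (fun _ => by positivity) hc,
    ENNReal.ofReal_eq_ofReal_iff (tsum_nonneg fun _ => by positivity)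
      (hs.nonneg fun _ => by positivity)] at hsw
  exact hsw ▸ hc.hasSum

variable (H) in
/-- An (arbitrarily chosen) orthonormal basis of `H`; every Hilbert space has one. -/
def basisSet : Set H := (exists_hilbertBasis ℂ H).choose

variable (H) in
/-- The chosen orthonormal basis as a Hilbert basis. -/
def basis : HilbertBasis (basisSet H) ℂ H := (exists_hilbertBasis ℂ H).choose_spec.choose

/-- `T` is trace class: the sum `∑ ⟨e_i, |T| e_i⟩` over an orthonormal basis is finite, where
`|T| = (T* T)^{1/2}`. -/
def IsTraceClass (T : H →L[ℂ] H) : Prop :=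
  Summable fun i => (⟪basis H i, CFC.abs T (basis H i)⟫_ℂ).re

/-- The trace `Tr T = ∑ ⟨e_i, T e_i⟩` of a trace class operator. -/
def trace (T : H →L[ℂ] H) : ℂ :=
  ∑' i, ⟪basis H i, T (basis H i)⟫_ℂ

/-- The operator power mean `M_p(a_1,…,a_n) = ((1/n) ∑ a_k^{1/p})^p`; the powers are those of the
continuous functional calculus. -/
def powerMean {n : ℕ} (p : ℝ) (a : Fin n → H →L[ℂ] H) : H →L[ℂ] H :=
  ((n : ℂ)⁻¹ • ∑ k, a k ^ (1 / p)) ^ p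

/-- The tracial geometric mean `TG(a_1,…,a_n) = lim_{p → ∞} Tr M_p(a_1,…,a_n)`. -/
def TG {n : ℕ} (a : Fin n → H →L[ℂ] H) : ℝ :=
  limUnder atTop fun p : ℝ => (trace (powerMean p a)).re

end TracialMean

end

/-!
The bounds on `Tr M_p` come from one device. Put `X = (1/m) ∑ a_k^{1/p}`, so that `M_p = X^p`. Trace
class operators are compact, hence so is `X`, and it has an orthonormal eigenbasis `(e_i)`. In that
basis `⟨e_i, X^p e_i⟩ = ⟨e_i, X e_i⟩^p`, that is,
`Tr M_p = ∑_i ((1/m) ∑_k ⟨e_i, a_k^{1/p} e_i⟩)^p`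
(`exists_hilbertBasis_re_inner_powerMean`). What remains is scalar, thanks to Jensen's inequality
`⟨v, A v⟩^q ≤ ⟨v, A^q v⟩` for unit vectors `v`, `A ≥ 0` and `q ≥ 1` (`re_inner_rpow_le`).

* For `p ≤ q`, take an eigenbasis for the exponent `q`. Jensen with exponent `q/p`, applied both to
  the operators `a_k^{1/q}` and to the mean over `k`, and then Jensen with exponent `p` give
  `Tr M_q ≤ Tr M_p` (`trace_powerMean_antitone`). So the limit defining `TG` exists.
* Jensen with exponent `p` bounds each term by `((1/m) ∑_k ⟨e_i, a_k e_i⟩^{1/p})^p`, and convexity of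
  `t ↦ t^p` bounds this linearly in the numbers `⟨e_i, a_k e_i⟩`, with freely chosen weights
  `c_k > 0`. Summing over `i` gives a bound of `Tr M_p` by a combination of the `Tr a_k`
  (`isTraceClass_powerMean_and_trace_le`), which also yields that `M_p` is trace class. As `p → ∞` it
  becomes `TG(a_1, …, a_m) ≤ (∏ c_k)^{-1/m} (1/m) ∑ c_k Tr a_k`.

With the weights `c_k = (k+1)^k / k^{k-1}` of Pólya's proof of the scalar Carleman inequality one has
`(∏_{k ≤ m} c_k)^{1/m} = m + 1`, and the sum over `m` telescopes, since
`∑_{m ≥ k} 1/(m(m+1)) = 1/k` and `c_k / k = (1 + 1/k)^k ≤ e`.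
-/

namespace TracialMean

universe u v

/-! ### Power means of real numbers and Carleman weights -/

/-- The power means with exponent `1/p` tend to the geometric mean: the logarithm of the left side
is the difference quotient at `0`, with step `1/p`, of the logarithm of `h ↦ (1/m) ∑ z_k ^ h`. -/
theorem tendsto_rpow_mean_exp_mean_log {m : ℕ} (hm : 0 < m) (z : Fin m → ℝ) (hz : ∀ k, 0 < z k) :
    Tendsto (fun p : ℝ => ((m : ℝ)⁻¹ * ∑ k, z k ^ (1 / p)) ^ p) atTop
      (𝓝 (Real.exp ((m : ℝ)⁻¹ * ∑ k, Real.log (z k)))) := by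
  have hm' : (0 : ℝ) < m := by exact_mod_cast hm
  have : Nonempty (Fin m) := ⟨⟨0, hm⟩⟩
  set G : ℝ → ℝ := fun h => (m : ℝ)⁻¹ * ∑ k, z k ^ h with hG
  have hG0 : G 0 = 1 := by simp [hG, hm'.ne']
  have hGpos : ∀ h, 0 < G h := fun h =>
    mul_pos (inv_pos.2 hm') (Finset.sum_pos (fun k _ => Real.rpow_pos_of_pos (hz k) _)
      Finset.univ_nonempty)
  have hG' : HasDerivAt G ((m : ℝ)⁻¹ * ∑ k, Real.log (z k)) 0 := by
    refine HasDerivAt.const_mul _ (HasDerivAt.fun_sum fun k _ => ?_)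
    simpa using (Real.hasStrictDerivAt_const_rpow (hz k) 0).hasDerivAt
  have hlog := (hG'.log (by rw [hG0]; exact one_ne_zero)).tendsto_slope_zero_right
  have h1 := hlog.comp (tendsto_inv_atTop_nhdsGT_zero (𝕜 := ℝ))
  have h2 := (Real.continuous_exp.tendsto _).comp h1
  simp only [hG0, div_one] at h2
  refine h2.congr' ?_
  filter_upwards [eventually_gt_atTop 0] with p hp
  simp only [Function.comp, zero_add, inv_inv, smul_eq_mul, Real.log_one, sub_zero, one_div]
  rw [Real.rpow_def_of_pos (hGpos _), mul_comm]

/-- A bound of the power mean of `d` that is linear in `d`, with arbitrary weights `c`: write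
`d_k ^ (1/p) = u_k (c_k d_k) ^ (1/p)` with `u_k = c_k⁻¹ ^ (1/p)`, and use the convexity of `t ↦ t ^ p`
for the normalised weights `u_k / ∑ u_j`. -/
theorem rpow_mean_rpow_inv_le {m : ℕ} (hm : 0 < m) {p : ℝ} (hp : 1 ≤ p) (c d : Fin m → ℝ)
    (hc : ∀ k, 0 < c k) (hd : ∀ k, 0 ≤ d k) :
    ((m : ℝ)⁻¹ * ∑ k, d k ^ (1 / p)) ^ p ≤
      ((m : ℝ)⁻¹ * ∑ k, (c k)⁻¹ ^ (1 / p)) ^ p *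
        ∑ k, (c k)⁻¹ ^ (1 / p) / (∑ j, (c j)⁻¹ ^ (1 / p)) * (c k * d k) := by
  have : Nonempty (Fin m) := ⟨⟨0, hm⟩⟩
  have hp0 : p ≠ 0 := by positivity
  have hu : ∀ k, 0 < (c k)⁻¹ ^ (1 / p) := fun k => Real.rpow_pos_of_pos (inv_pos.2 (hc k)) _
  set U := ∑ j, (c j)⁻¹ ^ (1 / p) with hU
  have hU0 : 0 < U := Finset.sum_pos (fun k _ => hu k) Finset.univ_nonempty
  have key := Real.rpow_arith_mean_le_arith_mean_rpow Finset.univ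
    (fun k => (c k)⁻¹ ^ (1 / p) / U) (fun k => (c k * d k) ^ (1 / p))
    (fun k _ => (div_pos (hu k) hU0).le)
    (by rw [← Finset.sum_div, ← hU, div_self hU0.ne'])
    (fun k _ => Real.rpow_nonneg (mul_nonneg (hc k).le (hd k)) _) hp
  have e1 : ∀ k, ((c k * d k) ^ (1 / p)) ^ p = c k * d k := fun k => by
    rw [← Real.rpow_mul (mul_nonneg (hc k).le (hd k)), one_div_mul_cancel hp0, Real.rpow_one]
  simp only [e1] at key
  have e2 : (m : ℝ)⁻¹ * ∑ k, d k ^ (1 / p) =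
      ((m : ℝ)⁻¹ * U) * ∑ k, (c k)⁻¹ ^ (1 / p) / U * (c k * d k) ^ (1 / p) := by
    rw [mul_assoc]
    congr 1
    rw [Finset.mul_sum]
    refine Finset.sum_congr rfl fun k _ => ?_
    rw [Real.mul_rpow (hc k).le (hd k), Real.inv_rpow (hc k).le]
    have := (Real.rpow_pos_of_pos (hc k) (1 / p)).ne'
    field_simp
  rw [e2, Real.mul_rpow (by positivity) (Finset.sum_nonneg fun k _ =>
    mul_nonneg (div_pos (hu k) hU0).le (Real.rpow_nonneg (mul_nonneg (hc k).le (hd k)) _))]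
  gcongr

/-- The weights `(j+1)^j / j^(j-1)` of Pólya's proof of Carleman's inequality, with `j = k + 1` so
that the index starts at `0`. -/
noncomputable def carlemanWeight (k : ℕ) : ℝ := (k + 2 : ℝ) ^ (k + 1) / (k + 1 : ℝ) ^ k

theorem carlemanWeight_pos (k : ℕ) : 0 < carlemanWeight k := by
  unfold carlemanWeight; positivity

theorem prod_carlemanWeight (n : ℕ) :
    ∏ k ∈ Finset.range n, carlemanWeight k = (n + 1 : ℝ) ^ n := by
  induction n with
  | zero => simp
  | succ n ih =>
    rw [Finset.prod_range_succ, ih, carlemanWeight]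
    push_cast
    field_simp
    ring

theorem carlemanWeight_le (k : ℕ) : carlemanWeight k / (k + 1) ≤ Real.exp 1 := by
  have h : carlemanWeight k / (k + 1) = (1 / (k + 1 : ℝ) + 1) ^ (k + 1) := by
    rw [carlemanWeight, div_add_one (by positivity), div_pow, div_div, ← pow_succ]
    ring
  rw [h]
  calc (1 / (k + 1 : ℝ) + 1) ^ (k + 1) ≤ Real.exp (1 / (k + 1 : ℝ)) ^ (k + 1) := by
        gcongr; exact Real.add_one_le_exp _
    _ = Real.exp 1 := by
        rw [← Real.exp_nat_mul]
        congr 1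
        push_cast
        field_simp

theorem tendsto_rpow_mean_carlemanWeight (n : ℕ) :
    Tendsto (fun p : ℝ => (((n + 1 : ℕ) : ℝ)⁻¹ *
      ∑ k : Fin (n + 1), (carlemanWeight k)⁻¹ ^ (1 / p)) ^ p) atTop (𝓝 (n + 2 : ℝ)⁻¹) := by
  have h := tendsto_rpow_mean_exp_mean_log n.succ_pos (fun k : Fin (n + 1) => (carlemanWeight k)⁻¹)
    fun k => inv_pos.2 (carlemanWeight_pos k)
  convert h using 2
  rw [← Real.log_prod fun k _ => (inv_pos.2 (carlemanWeight_pos _)).ne', Finset.prod_inv_distrib,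
    Fin.prod_univ_eq_prod_range carlemanWeight (n + 1), prod_carlemanWeight, Real.log_inv,
    Real.log_pow, mul_neg, inv_mul_cancel_left₀ (by positivity), Real.exp_neg,
    Real.exp_log (by positivity)]
  push_cast
  ring

/-- The double sum, evaluated by telescoping `1 / ((n+1)(n+2)) = 1 / (n+1) - 1 / (n+2)`. -/
theorem sum_range_mean_carlemanWeight (t : ℕ → ℝ) (N : ℕ) :
    ∑ n ∈ Finset.range N, ((n + 1 : ℝ) * (n + 2))⁻¹ *
        ∑ k ∈ Finset.range (n + 1), carlemanWeight k * t k =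
      ∑ k ∈ Finset.range N, carlemanWeight k / (k + 1) * t k -
        (N + 1 : ℝ)⁻¹ * ∑ k ∈ Finset.range N, carlemanWeight k * t k := by
  induction N with
  | zero => simp
  | succ N ih =>
    rw [Finset.sum_range_succ, ih, Finset.sum_range_succ (fun k => carlemanWeight k / (k + 1) * t k),
      Finset.sum_range_succ (fun k => carlemanWeight k * t k)]
    push_cast
    field_simp
    ring

theorem sum_range_mean_carlemanWeight_le (t : ℕ → ℝ) (ht : ∀ k, 0 ≤ t k) (hs : Summable t) (N : ℕ) :
    ∑ n ∈ Finset.range N, ((n + 1 : ℝ) * (n + 2))⁻¹ *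
        ∑ k ∈ Finset.range (n + 1), carlemanWeight k * t k ≤ Real.exp 1 * ∑' k, t k := by
  rw [sum_range_mean_carlemanWeight]
  have h1 : 0 ≤ (N + 1 : ℝ)⁻¹ * ∑ k ∈ Finset.range N, carlemanWeight k * t k :=
    mul_nonneg (by positivity)
      (Finset.sum_nonneg fun k _ => mul_nonneg (carlemanWeight_pos k).le (ht k))
  calc _ ≤ ∑ k ∈ Finset.range N, carlemanWeight k / (k + 1) * t k := by linarith
    _ ≤ ∑ k ∈ Finset.range N, Real.exp 1 * t k :=
        Finset.sum_le_sum fun k _ => mul_le_mul_of_nonneg_right (carlemanWeight_le k) (ht k)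
    _ = Real.exp 1 * ∑ k ∈ Finset.range N, t k := by rw [Finset.mul_sum]
    _ ≤ _ := by
        gcongr
        exact hs.sum_le_tsum _ fun k _ => ht k

/-! ### Jensen's inequality and eigenvectors -/

theorem re_inner_apply_nonneg {H : Type*} [NormedAddCommGroup H] [InnerProductSpace ℂ H]
    {T : H →L[ℂ] H} (hT : 0 ≤ T) (v : H) :
    0 ≤ (⟪v, T v⟫_ℂ).re :=
  ((ContinuousLinearMap.nonneg_iff_isPositive T).1 hT).re_inner_nonneg_right v

variable {H : Type u} [NormedAddCommGroup H] [InnerProductSpace ℂ H] [CompleteSpace H]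

/-- The convex function `t ↦ t ^ q` lies above its tangent line at `s`. -/
theorem rpow_tangent_le {s t q : ℝ} (hs : 0 ≤ s) (ht : 0 ≤ t) (hq : 1 ≤ q) :
    (q * s ^ (q - 1)) * t + (s ^ q - q * s ^ (q - 1) * s) ≤ t ^ q := by
  rcases hs.eq_or_lt with rfl | hs
  · rcases hq.eq_or_lt with rfl | hq
    · simp
    · simp [Real.zero_rpow (by linarith : q - 1 ≠ 0), Real.zero_rpow (by linarith : q ≠ 0),
        Real.rpow_nonneg ht]
  · have h := one_add_mul_self_le_rpow_one_add (s := t / s - 1)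
      (by linarith [div_nonneg ht hs.le]) hq
    rw [add_sub_cancel, Real.div_rpow ht hs.le, le_div_iff₀ (Real.rpow_pos_of_pos hs q)] at h
    refine le_trans (le_of_eq ?_) h
    rw [Real.rpow_sub_one hs.ne']
    field_simp
    ring

/-- Jensen's inequality for the vector state of a unit vector: integrate the tangent line bound at
`s = ⟨v, A v⟩` through the functional calculus. -/
theorem re_inner_rpow_le {A : H →L[ℂ] H} (hA : 0 ≤ A) {q : ℝ} (hq : 1 ≤ q) {v : H}
    (hv : ‖v‖ = 1) : (⟪v, A v⟫_ℂ).re ^ q ≤ (⟪v, (A ^ q) v⟫_ℂ).re := by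
  set s := (⟪v, A v⟫_ℂ).re with hs
  have hs0 : 0 ≤ s := ((ContinuousLinearMap.nonneg_iff_isPositive A).1 hA).re_inner_nonneg_right v
  have hle : (q * s ^ (q - 1)) • A + algebraMap ℝ (H →L[ℂ] H) (s ^ q - q * s ^ (q - 1) * s)
      ≤ A ^ q := by
    rw [CFC.rpow_eq_cfc_real hA]
    have hsa : IsSelfAdjoint A := IsSelfAdjoint.of_nonneg hA
    have e : (q * s ^ (q - 1)) • A + algebraMap ℝ (H →L[ℂ] H) (s ^ q - q * s ^ (q - 1) * s) =
        cfc (fun t : ℝ => (q * s ^ (q - 1)) * t + (s ^ q - q * s ^ (q - 1) * s)) A := by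
      rw [cfc_add_const _ _ A, cfc_const_mul_id _ A]
    rw [e]
    exact cfc_mono (fun t ht => rpow_tangent_le hs0 (spectrum_nonneg_of_nonneg hA ht) hq)
      (by fun_prop) (Real.continuous_rpow_const (by linarith)).continuousOn
  have h := ((ContinuousLinearMap.le_def _ _).1 hle).re_inner_nonneg_right v
  simp [inner_sub_right, inner_add_right, Algebra.algebraMap_eq_smul_one, inner_smul_right_eq_smul,
    hv, ← hs] at h
  linarith

/-- An eigenvector of `A` is an eigenvector of `f(A)`, with eigenvalue `f` at the old one. -/
theorem cfc_apply_of_eigenvector {A : H →L[ℂ] H} (hA : IsSelfAdjoint A) {r : ℝ} {v : H}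
    (hv : v ≠ 0) (h : A v = (r : ℂ) • v) (f : ℝ → ℝ) (hf : ContinuousOn f (spectrum ℝ A)) :
    cfc f A v = (f r : ℂ) • v := by
  have hr : r ∈ spectrum ℝ A := by
    -- A left inverse of `r - A` would send `0 = (r - A) v` to `v ≠ 0`.
    rw [spectrum.mem_iff]
    intro hu
    obtain ⟨B, hB⟩ := hu.exists_left_inv
    apply hv
    have h0 : (algebraMap ℝ (H →L[ℂ] H) r - A) v = 0 := by
      simp [Algebra.algebraMap_eq_smul_one, h]
    have := congrArg (fun T : H →L[ℂ] H => T v) hB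
    simpa [h0] using this.symm
  rw [cfc_apply f A hA hf]
  have key : ∀ g : C(spectrum ℝ A, ℝ), cfcHom hA g v = (g ⟨r, hr⟩ : ℂ) • v := by
    intro g
    induction g using ContinuousMap.induction_on_of_compact with
    | const c =>
      have : ContinuousMap.const (spectrum ℝ A) c = algebraMap ℝ C(spectrum ℝ A, ℝ) c := rfl
      rw [this, AlgHomClass.commutes]
      simp [Algebra.algebraMap_eq_smul_one]
    | id => rw [cfcHom_id hA, h]; simp
    | star_id => rw [map_star, cfcHom_id hA, hA.star_eq, h]; simp
    | add f g hf hg => simp [map_add, hf, hg, add_smul]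
    | mul f g hf hg => 
      rw [map_mul, mul_apply_eq_comp, hg, map_smul, hf, smul_smul,
        ContinuousMap.mul_apply, Complex.ofReal_mul, mul_comm]
    | frequently f hf =>
      have hc : IsClosed {g : C(spectrum ℝ A, ℝ) | cfcHom hA g v = (g ⟨r, hr⟩ : ℂ) • v} := by
        refine isClosed_eq ?_ ?_
        · exact (ContinuousLinearMap.apply ℂ H v).continuous.comp (cfcHom_continuous hA)
        · exact (Complex.continuous_ofReal.comp (continuous_eval_const _)).smul
            continuous_const
      exact hc.mem_of_frequently_of_tendsto hf tendsto_id
  exact key _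

theorem re_inner_rpow_one_div_le {A : H →L[ℂ] H} (hA : 0 ≤ A) {q : ℝ} (hq : 1 ≤ q) {v : H}
    (hv : ‖v‖ = 1) : (⟪v, (A ^ (1 / q)) v⟫_ℂ).re ≤ (⟪v, A v⟫_ℂ).re ^ (1 / q) := by
  have hq0 : 0 < q := by linarith
  have h0 : (0 : H →L[ℂ] H) ≤ A ^ (1 / q) := CFC.rpow_nonneg
  have h := re_inner_rpow_le h0 hq hv
  rw [CFC.rpow_rpow_of_exponent_nonneg _ _ _ (by positivity) hq0.le hA, one_div_mul_cancel hq0.ne',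
    CFC.rpow_one A hA] at h
  have hx := re_inner_apply_nonneg h0 v
  rw [one_div] at hx h ⊢
  rw [Real.le_rpow_inv_iff_of_pos hx (le_trans (Real.rpow_nonneg hx _) h) hq0]
  exact h

/-- For unit eigenvectors, equality holds in Jensen's inequality `re_inner_rpow_le`. -/
theorem re_inner_rpow_of_eigenvector {A : H →L[ℂ] H} (hA : 0 ≤ A) {q : ℝ} (hq : 0 ≤ q) {v : H}
    (hv : ‖v‖ = 1) (h : ∃ μ : ℂ, A v = μ • v) :
    (⟪v, (A ^ q) v⟫_ℂ).re = (⟪v, A v⟫_ℂ).re ^ q := by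
  obtain ⟨μ, h⟩ := h
  have hvv : ⟪v, v⟫_ℂ = 1 := by simp [inner_self_eq_norm_sq_to_K, hv]
  have hin : ⟪v, A v⟫_ℂ = μ := by rw [h, inner_smul_right, hvv, mul_one]
  have hpos := (ContinuousLinearMap.nonneg_iff_isPositive A).1 hA
  have hre : ⟪v, A v⟫_ℂ = ((⟪v, A v⟫_ℂ).re : ℂ) :=
    (hpos.isSymmetric.coe_re_inner_self_apply v).symm
  rw [hin] at hre ⊢
  rw [hre] at h
  rw [CFC.rpow_eq_cfc_real hA, cfc_apply_of_eigenvector (IsSelfAdjoint.of_nonneg hA)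
    (by rintro rfl; simp at hv) h _ (Real.continuous_rpow_const hq).continuousOn,
    inner_smul_right, hvv, mul_one, Complex.ofReal_re]

/-! ### Compact operators -/

/-- The compact operators whose adjoint is compact. By Schauder's theorem these are all the compact
operators; asking for both spares that theorem. -/
def compactStarSubalgebra : NonUnitalStarSubalgebra ℂ (H →L[ℂ] H) where
  carrier := {T | IsCompactOperator T ∧ IsCompactOperator (star T : H →L[ℂ] H)}
  add_mem' hS hT := ⟨hS.1.add hT.1, by rw [star_add]; exact hS.2.add hT.2⟩
  zero_mem' := ⟨isCompactOperator_zero, by rw [star_zero]; exact isCompactOperator_zero⟩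
  mul_mem' hS hT := ⟨hS.1.comp_clm _, by rw [star_mul]; exact hT.2.comp_clm _⟩
  smul_mem' c T hT := ⟨hT.1.smul c, by rw [star_smul]; exact hT.2.smul _⟩
  star_mem' hT := ⟨hT.2, by rw [star_star]; exact hT.1⟩

theorem isClosed_compactStarSubalgebra :
    IsClosed ((compactStarSubalgebra : NonUnitalStarSubalgebra ℂ (H →L[ℂ] H)) : Set (H →L[ℂ] H)) :=
  by
  have h : IsClosed {T : H →L[ℂ] H | IsCompactOperator T} := isClosed_setOfPred_isCompactOperator
  exact h.inter (h.preimage (continuous_star (R := H →L[ℂ] H)))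

/-- Positive powers of compact positive operators are compact: `t ↦ t ^ s` vanishes at `0`, so the
non-unital functional calculus stays in the closed subalgebra of compact operators. -/
theorem isCompactOperator_rpow {T : H →L[ℂ] H} (hT : 0 ≤ T) (hc : IsCompactOperator T) {s : ℝ}
    (hs : 0 < s) : IsCompactOperator (T ^ s) := by
  lift s to NNReal using hs.le
  rw [← CFC.nnrpow_eq_rpow (by exact_mod_cast hs), CFC.nnrpow_def]
  have : IsClosed ((compactStarSubalgebra : NonUnitalStarSubalgebra ℂ (H →L[ℂ] H)) :
    Set (H →L[ℂ] H)) := isClosed_compactStarSubalgebra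
  have hm : T ∈ (compactStarSubalgebra : NonUnitalStarSubalgebra ℂ (H →L[ℂ] H)) :=
    ⟨hc, by rw [(IsSelfAdjoint.of_nonneg hT).star_eq]; exact hc⟩
  rw [cfcₙ_nnreal_eq_real _ _ hT]
  exact (cfcₙ_mem (𝕜 := ℝ) (𝕜' := ℂ) _ hm).1

/-- Orthonormal bases of mutually orthogonal closed subspaces with dense sum join to a basis of the
whole space. -/
theorem exists_hilbertBasis_of_orthogonalFamily {κ : Type v} (V : κ → Submodule ℂ H)
    (hV : ∀ μ, IsClosed (V μ : Set H))
    (ho : OrthogonalFamily ℂ (fun μ => V μ) fun μ => (V μ).subtypeₗᵢ) (hbot : (⨆ μ, V μ)ᗮ = ⊥) :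
    ∃ (ι : Type (max u v)) (b : HilbertBasis ι ℂ H), ∀ i, ∃ μ, b i ∈ V μ := by
  have hcomp : ∀ μ, CompleteSpace (V μ) := fun μ => (hV μ).completeSpace_coe
  choose w b _ using fun μ => exists_hilbertBasis ℂ (V μ)
  have hon := ho.orthonormal_sigma_orthonormal fun μ => (b μ).orthonormal
  have hspan : (Submodule.span ℂ (Set.range fun a : Σ μ, w μ =>
      (V a.1).subtypeₗᵢ (b a.1 a.2)))ᗮ = ⊥ := by
    rw [eq_bot_iff, ← hbot]
    intro x hx
    rw [← Submodule.iInf_orthogonal, Submodule.mem_iInf]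
    intro μ
    rw [Submodule.mem_orthogonal']
    intro y hy
    have hsum := ((b μ).hasSum_repr ⟨y, hy⟩).mapL ((innerSL ℂ x).comp (V μ).subtypeL)
    refine hsum.unique ?_
    convert hasSum_zero with i
    have hi : ⟪x, (b μ i : H)⟫_ℂ = 0 :=
      (Submodule.mem_orthogonal' _ _).1 hx _ (Submodule.subset_span ⟨⟨μ, i⟩, rfl⟩)
    simp [hi]
  refine ⟨_, HilbertBasis.mkOfOrthogonalEqBot hon hspan, fun a => ⟨a.1, ?_⟩⟩
  rw [HilbertBasis.coe_mkOfOrthogonalEqBot]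
  exact (b a.1 a.2).2

/-- The spectral theorem for compact self-adjoint operators, in the form of an eigenbasis. -/
theorem exists_hilbertBasis_eigenvector {T : H →L[ℂ] H} (hT : T.IsSymmetric)
    (hc : IsCompactOperator T) :
    ∃ (ι : Type u) (b : HilbertBasis ι ℂ H), ∀ i, ∃ μ : ℂ, T (b i) = μ • b i := by
  obtain ⟨ι, b, h⟩ := exists_hilbertBasis_of_orthogonalFamily
    (fun μ : ℂ => Module.End.eigenspace (T : Module.End ℂ H) μ) (fun μ => by
      have : (Module.End.eigenspace (T : Module.End ℂ H) μ : Set H) = {x | T x = μ • x} := by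
        ext x; exact Module.End.mem_eigenspace_iff
      rw [this]
      exact isClosed_eq T.continuous (continuous_const_smul μ))
    hT.orthogonalFamily_eigenspaces
    (ContinuousLinearMap.orthogonalComplement_iSup_eigenspaces_eq_bot hc hT)
  exact ⟨ι, b, fun i => (h i).imp fun μ hμ => Module.End.mem_eigenspace_iff.1 hμ⟩

/-- A symmetric Hilbert–Schmidt operator is compact: with `P` the projection onto the span of
finitely many basis vectors, `‖S - P S‖²` is at most the remaining part of the sum
`∑ ‖S (b i)‖²`. -/
theorem isCompactOperator_of_summable_norm_sq {ι : Type*} (b : HilbertBasis ι ℂ H) {S : H →L[ℂ] H}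
    (hS : S.IsSymmetric) (hs : Summable fun i => ‖S (b i)‖ ^ 2) : IsCompactOperator S := by
  let F : Finset ι → H →L[ℂ] H := fun s => ∑ i ∈ s, InnerProductSpace.rankOne ℂ (b i) (S (b i))
  have hFapp : ∀ s x, F s x = ∑ i ∈ s, ⟪b i, S x⟫_ℂ • b i := by
    intro s x
    simp only [F, _root_.sum_apply, InnerProductSpace.rankOne_apply]
    exact Finset.sum_congr rfl fun i _ => congrArg (· • b i) (hS (b i) x)
  have hF : ∀ s, IsCompactOperator (F s) := by
    intro s
    refine Submodule.sum_mem (compactOperator (RingHom.id ℂ) H H) (t := s) fun i _ => ?_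
    rw [InnerProductSpace.rankOne_def']
    exact (isCompactOperator_of_locallyCompactSpace_rng
      (ContinuousLinearMap.toSpanSingleton ℂ (b i))).comp_clm _
  -- Parseval for `(S - F s) x`, whose coefficients vanish on `s` and are `⟪S (b i), x⟫` off `s`.
  have hnorm : ∀ s, ‖S - F s‖ ≤ √(∑' i, ‖S (b i)‖ ^ 2 - ∑ i ∈ s, ‖S (b i)‖ ^ 2) := by
    intro s
    refine ContinuousLinearMap.opNorm_le_bound _ (Real.sqrt_nonneg _) fun x => ?_
    have hle : ∑ i ∈ s, ‖S (b i)‖ ^ 2 ≤ ∑' i, ‖S (b i)‖ ^ 2 :=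
      hs.sum_le_tsum s fun _ _ => by positivity
    rw [← Real.sqrt_sq (norm_nonneg x), ← Real.sqrt_mul (by linarith)]
    refine Real.le_sqrt_of_sq_le ?_
    have h1 := hasSum_sq_norm_inner b ((S - F s) x)
    have h2 : HasSum (fun i => (‖S (b i)‖ ^ 2 - (s : Set ι).indicator (fun i => ‖S (b i)‖ ^ 2) i)
        * ‖x‖ ^ 2) ((∑' i, ‖S (b i)‖ ^ 2 - ∑ i ∈ s, ‖S (b i)‖ ^ 2) * ‖x‖ ^ 2) :=
      (hs.hasSum.sub (hasSum_subtype_iff_indicator.1 (s.hasSum _))).mul_right _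
    refine hasSum_le (fun i => ?_) h1 h2
    classical
    have hi : ⟪b i, (S - F s) x⟫_ℂ = if i ∈ s then 0 else ⟪b i, S x⟫_ℂ := by
      rw [_root_.sub_apply, hFapp, inner_sub_right]
      split_ifs with h
      · rw [b.orthonormal.inner_right_sum _ h, sub_self]
      · rw [inner_sum, Finset.sum_eq_zero, sub_zero]
        intro j hj
        rw [inner_smul_right, b.orthonormal.2 (fun e => h (by rwa [e])), mul_zero]
    rw [hi]
    by_cases h : i ∈ s
    · simp [h]
    · simp only [h, if_false, Finset.mem_coe, not_false_eq_true, Set.indicator_of_notMem, sub_zero]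
      rw [show ⟪b i, S x⟫_ℂ = ⟪S (b i), x⟫_ℂ from (hS (b i) x).symm, ← mul_pow]
      gcongr
      exact norm_inner_le_norm _ _
  have hlim : Tendsto F atTop (𝓝 S) := by
    rw [tendsto_iff_norm_sub_tendsto_zero]
    refine squeeze_zero (fun _ => norm_nonneg _)
      (fun s => (norm_sub_rev (F s) S).trans_le (hnorm s)) ?_
    have h := (Real.continuous_sqrt.tendsto _).comp (hs.hasSum.const_sub (∑' i, ‖S (b i)‖ ^ 2))
    simpa [Function.comp_def] using h
  exact isCompactOperator_of_tendsto hlim (.of_forall hF)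

/-! ### Trace class operators -/

/-- For positive operators, trace class and trace can be read off in any orthonormal basis. -/
theorem isTraceClass_and_trace_of_hasSum {ι : Type*} (b : HilbertBasis ι ℂ H) {T : H →L[ℂ] H}
    (hT : 0 ≤ T) {s : ℝ} (hs : HasSum (fun i => (⟪b i, T (b i)⟫_ℂ).re) s) :
    IsTraceClass T ∧ (trace T).re = s := by
  have hpos := (ContinuousLinearMap.nonneg_iff_isPositive T).1 hT
  have h := hasSum_diag_of_hasSum_diag b (basis H) hpos hs
  refine ⟨by rw [IsTraceClass, CFC.abs_of_nonneg T hT]; exact h.summable, ?_⟩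
  have hre : ∀ x, ⟪x, T x⟫_ℂ = ((⟪x, T x⟫_ℂ).re : ℂ) := fun x =>
    (hpos.isSymmetric.coe_re_inner_self_apply x).symm
  have h' : HasSum (fun i => ⟪basis H i, T (basis H i)⟫_ℂ) (s : ℂ) := by
    rw [funext fun i => hre (basis H i)]
    exact Complex.hasSum_ofReal.2 h
  rw [trace, h'.tsum_eq, Complex.ofReal_re]

theorem IsTraceClass.hasSum_inner {ι : Type*} (b : HilbertBasis ι ℂ H) {T : H →L[ℂ] H}
    (hT : 0 ≤ T) (h : IsTraceClass T) :
    HasSum (fun i => (⟪b i, T (b i)⟫_ℂ).re) (trace T).re := by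
  rw [IsTraceClass, CFC.abs_of_nonneg T hT] at h
  have hpos := (ContinuousLinearMap.nonneg_iff_isPositive T).1 hT
  rw [(isTraceClass_and_trace_of_hasSum _ hT h.hasSum).2]
  exact hasSum_diag_of_hasSum_diag _ b hpos h.hasSum

/-- The square root of a positive trace class operator is Hilbert–Schmidt. -/
theorem isCompactOperator_of_isTraceClass {T : H →L[ℂ] H} (hT : 0 ≤ T) (h : IsTraceClass T) :
    IsCompactOperator T := by
  have hS := (ContinuousLinearMap.nonneg_iff_isPositive _).1 (CFC.sqrt_nonneg T)
  have hc : IsCompactOperator (CFC.sqrt T : H →L[ℂ] H) := by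
    refine isCompactOperator_of_summable_norm_sq (basis H) hS.isSymmetric ?_
    refine (h.hasSum_inner (basis H) hT).summable.congr fun i => ?_
    conv_lhs => rw [← CFC.sqrt_mul_sqrt_self T hT, mul_apply_eq_comp]
    have e : ∀ x y : H, ⟪x, CFC.sqrt T y⟫_ℂ = ⟪CFC.sqrt T x, y⟫_ℂ := fun x y =>
      (hS.isSymmetric x y).symm
    rw [e]
    exact inner_self_eq_norm_sq (𝕜 := ℂ) _
  rw [← CFC.sqrt_mul_sqrt_self T hT]
  exact hc.comp_clm _

/-! ### Traces of operator power means -/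

variable {m : ℕ}

/-- The mean `(1/m) ∑ a_k^{1/p}`, whose `p`-th power is the operator power mean. -/
noncomputable def rootMean (p : ℝ) (a : Fin m → H →L[ℂ] H) : H →L[ℂ] H :=
  (m : ℂ)⁻¹ • ∑ k, a k ^ (1 / p)

theorem powerMean_eq (p : ℝ) (a : Fin m → H →L[ℂ] H) : powerMean p a = rootMean p a ^ p := rfl

theorem re_inner_rootMean (p : ℝ) (a : Fin m → H →L[ℂ] H) (v : H) :
    (⟪v, rootMean p a v⟫_ℂ).re = (m : ℝ)⁻¹ * ∑ k, (⟪v, (a k ^ (1 / p)) v⟫_ℂ).re := by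
  rw [rootMean, smul_apply, inner_smul_right, _root_.sum_apply, inner_sum,
    show ((m : ℂ)⁻¹) = (((m : ℝ)⁻¹ : ℝ) : ℂ) by push_cast; rfl, Complex.re_ofReal_mul,
    Complex.re_sum]

theorem rootMean_nonneg (p : ℝ) (a : Fin m → H →L[ℂ] H) : 0 ≤ rootMean p a := by
  have h : rootMean p a = (m : ℝ)⁻¹ • ∑ k, a k ^ (1 / p) := by
    rw [rootMean, ← Complex.coe_smul]
    push_cast
    rfl
  rw [h]
  exact smul_nonneg (by positivity) (Finset.sum_nonneg fun k _ => CFC.rpow_nonneg)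

theorem isCompactOperator_rootMean {p : ℝ} (hp : 0 < p) {a : Fin m → H →L[ℂ] H}
    (ha : ∀ k, 0 ≤ a k) (htr : ∀ k, IsTraceClass (a k)) : IsCompactOperator (rootMean p a) := by
  refine Submodule.smul_mem (compactOperator (RingHom.id ℂ) H H) _
    (Submodule.sum_mem _ fun k _ => ?_)
  exact isCompactOperator_rpow (ha k) (isCompactOperator_of_isTraceClass (ha k) (htr k))
    (by positivity)

/-- In an eigenbasis of `rootMean p a`, the diagonal entries of the power mean are the `p`-th powers
of those of `rootMean p a`. -/
theorem exists_hilbertBasis_re_inner_powerMean {p : ℝ} (hp : 0 < p) {a : Fin m → H →L[ℂ] H}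
    (ha : ∀ k, 0 ≤ a k) (htr : ∀ k, IsTraceClass (a k)) :
    ∃ (ι : Type u) (b : HilbertBasis ι ℂ H), ∀ i, (⟪b i, powerMean p a (b i)⟫_ℂ).re =
      ((m : ℝ)⁻¹ * ∑ k, (⟪b i, (a k ^ (1 / p)) (b i)⟫_ℂ).re) ^ p := by
  have h0 := rootMean_nonneg p a
  obtain ⟨ι, b, hb⟩ := exists_hilbertBasis_eigenvector
    ((ContinuousLinearMap.nonneg_iff_isPositive _).1 h0).isSymmetric
    (isCompactOperator_rootMean hp ha htr)
  refine ⟨ι, b, fun i => ?_⟩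
  rw [powerMean_eq, re_inner_rpow_of_eigenvector h0 hp.le (b.orthonormal.1 i) (hb i),
    re_inner_rootMean]

theorem powerMean_nonneg (p : ℝ) (a : Fin m → H →L[ℂ] H) : 0 ≤ powerMean p a := CFC.rpow_nonneg

theorem trace_nonneg {T : H →L[ℂ] H} (hT : 0 ≤ T) (h : IsTraceClass T) : 0 ≤ (trace T).re :=
  (h.hasSum_inner (basis H) hT).nonneg fun _ => re_inner_apply_nonneg hT _

/-- The power mean of trace class operators is trace class, and its trace is bounded by a linear
combination of theirs, for any weights `c`. -/
theorem isTraceClass_powerMean_and_trace_le (hm : 0 < m) {p : ℝ} (hp : 1 ≤ p)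
    {a : Fin m → H →L[ℂ] H}
    (ha : ∀ k, 0 ≤ a k) (htr : ∀ k, IsTraceClass (a k)) (c : Fin m → ℝ) (hc : ∀ k, 0 < c k) :
    IsTraceClass (powerMean p a) ∧ (trace (powerMean p a)).re ≤
      ((m : ℝ)⁻¹ * ∑ k, (c k)⁻¹ ^ (1 / p)) ^ p *
        ∑ k, (c k)⁻¹ ^ (1 / p) / (∑ j, (c j)⁻¹ ^ (1 / p)) * (c k * (trace (a k)).re) := by
  obtain ⟨ι, b, hb⟩ := exists_hilbertBasis_re_inner_powerMean (by linarith) ha htr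
  have hle : ∀ i, (⟪b i, powerMean p a (b i)⟫_ℂ).re ≤
      ((m : ℝ)⁻¹ * ∑ k, (c k)⁻¹ ^ (1 / p)) ^ p * ∑ k, (c k)⁻¹ ^ (1 / p) /
        (∑ j, (c j)⁻¹ ^ (1 / p)) * (c k * (⟪b i, a k (b i)⟫_ℂ).re) := fun i => by
    rw [hb i]
    refine le_trans ?_ (rpow_mean_rpow_inv_le hm hp c (fun k => (⟪b i, a k (b i)⟫_ℂ).re) hc
      fun k => re_inner_apply_nonneg (ha k) _)
    refine Real.rpow_le_rpow (mul_nonneg (by positivity) (Finset.sum_nonneg fun k _ =>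
      re_inner_apply_nonneg CFC.rpow_nonneg _)) ?_ (by linarith)
    gcongr with k
    exact re_inner_rpow_one_div_le (ha k) hp (b.orthonormal.1 i)
  have hsum := (hasSum_sum fun k (_ : k ∈ Finset.univ) =>
    (((htr k).hasSum_inner b (ha k)).mul_left (c k)).mul_left
      ((c k)⁻¹ ^ (1 / p) / (∑ j, (c j)⁻¹ ^ (1 / p)))).mul_left
        (((m : ℝ)⁻¹ * ∑ k, (c k)⁻¹ ^ (1 / p)) ^ p)
  have hs : Summable fun i => (⟪b i, powerMean p a (b i)⟫_ℂ).re :=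
    hsum.summable.of_nonneg_of_le (fun i => re_inner_apply_nonneg (powerMean_nonneg p a) _) hle
  obtain ⟨h1, h2⟩ := isTraceClass_and_trace_of_hasSum b (powerMean_nonneg p a) hs.hasSum
  exact ⟨h1, h2 ▸ hasSum_le hle hs.hasSum hsum⟩

/-- The trace of the power mean decreases in the exponent; the comparison takes place entry by entry
in an eigenbasis belonging to the larger exponent `q`. -/
theorem trace_powerMean_antitone (hm : 0 < m) {p q : ℝ} (hp : 1 ≤ p) (hpq : p ≤ q)
    {a : Fin m → H →L[ℂ] H} (ha : ∀ k, 0 ≤ a k) (htr : ∀ k, IsTraceClass (a k)) :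
    (trace (powerMean q a)).re ≤ (trace (powerMean p a)).re := by
  have hp0 : 0 < p := by linarith
  have hq0 : 0 < q := by linarith
  have hr : 1 ≤ q / p := (one_le_div hp0).2 hpq
  obtain ⟨ι, b, hb⟩ := exists_hilbertBasis_re_inner_powerMean hq0 ha htr
  have htc : ∀ s, 1 ≤ s → IsTraceClass (powerMean s a) := fun s hs =>
    (isTraceClass_powerMean_and_trace_le hm hs ha htr (fun _ => 1) fun _ => one_pos).1
  refine hasSum_le (fun i => ?_) ((htc q (hp.trans hpq)).hasSum_inner b (powerMean_nonneg q a))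
    ((htc p hp).hasSum_inner b (powerMean_nonneg p a))
  set v := b i
  have hv : ‖v‖ = 1 := b.orthonormal.1 i
  set x : Fin m → ℝ := fun k => (⟪v, (a k ^ (1 / q)) v⟫_ℂ).re with hx
  set y : Fin m → ℝ := fun k => (⟪v, (a k ^ (1 / p)) v⟫_ℂ).re with hy
  have hx0 : ∀ k, 0 ≤ x k := fun k => re_inner_apply_nonneg CFC.rpow_nonneg _
  have hxy : ∀ k, x k ^ (q / p) ≤ y k := fun k => by
    have h := re_inner_rpow_le (A := a k ^ (1 / q)) CFC.rpow_nonneg hr hv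
    rwa [CFC.rpow_rpow_of_exponent_nonneg _ _ _ (by positivity) (by positivity) (ha k),
      one_div_mul_eq_div, div_div_cancel_left' hq0.ne', ← one_div] at h
  have hmean : ((m : ℝ)⁻¹ * ∑ k, x k) ^ (q / p) ≤ (m : ℝ)⁻¹ * ∑ k, y k := by
    have h := Real.rpow_arith_mean_le_arith_mean_rpow Finset.univ (fun _ => (m : ℝ)⁻¹) x
      (fun _ _ => by positivity) (by simp [hm.ne']) (fun k _ => hx0 k) hr
    rw [← Finset.mul_sum, ← Finset.mul_sum] at h
    refine h.trans ?_
    gcongr with k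
    exact hxy k
  have hX : 0 ≤ (m : ℝ)⁻¹ * ∑ k, x k :=
    mul_nonneg (by positivity) (Finset.sum_nonneg fun k _ => hx0 k)
  calc (⟪v, powerMean q a v⟫_ℂ).re = ((m : ℝ)⁻¹ * ∑ k, x k) ^ q := hb i
    _ = (((m : ℝ)⁻¹ * ∑ k, x k) ^ (q / p)) ^ p := by
        rw [← Real.rpow_mul hX, div_mul_cancel₀ _ hp0.ne']
    _ ≤ ((m : ℝ)⁻¹ * ∑ k, y k) ^ p :=
        Real.rpow_le_rpow (Real.rpow_nonneg hX _) hmean hp0.le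
    _ = (⟪v, rootMean p a v⟫_ℂ).re ^ p := by rw [re_inner_rootMean]
    _ ≤ (⟪v, powerMean p a v⟫_ℂ).re := re_inner_rpow_le (rootMean_nonneg p a) hp hv

theorem tendsto_trace_powerMean (hm : 0 < m) {a : Fin m → H →L[ℂ] H} (ha : ∀ k, 0 ≤ a k)
    (htr : ∀ k, IsTraceClass (a k)) :
    Tendsto (fun p : ℝ => (trace (powerMean p a)).re) atTop (𝓝 (TG a)) := by
  refine tendsto_nhds_limUnder ?_
  -- Monotonicity is only known from exponent `1` on, so the exponent is truncated there.
  set f : ℝ → ℝ := fun p => (trace (powerMean (max 1 p) a)).re with hf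
  have hanti : Antitone f := fun p q hpq =>
    trace_powerMean_antitone hm (le_max_left _ _) (max_le_max_left 1 hpq) ha htr
  have hbdd : BddBelow (Set.range f) := by
    refine ⟨0, ?_⟩
    rintro _ ⟨p, rfl⟩
    exact trace_nonneg (powerMean_nonneg _ a)
      (isTraceClass_powerMean_and_trace_le hm (le_max_left 1 p) ha htr (fun _ => 1) fun _ => one_pos).1
  refine ⟨_, (tendsto_atTop_ciInf hanti hbdd).congr' ?_⟩
  filter_upwards [eventually_ge_atTop 1] with p hp
  simp only [hf, max_eq_right hp]

theorem TG_nonneg (hm : 0 < m) {a : Fin m → H →L[ℂ] H} (ha : ∀ k, 0 ≤ a k)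
    (htr : ∀ k, IsTraceClass (a k)) : 0 ≤ TG a := by
  refine ge_of_tendsto (tendsto_trace_powerMean hm ha htr) ?_
  filter_upwards [eventually_ge_atTop 1] with p hp
  exact trace_nonneg (powerMean_nonneg p a)
    (isTraceClass_powerMean_and_trace_le hm hp ha htr (fun _ => 1) fun _ => one_pos).1

/-- The limit `p → ∞` of the trace bound with the Carleman weights. -/
theorem TG_le {n : ℕ} {a : Fin (n + 1) → H →L[ℂ] H} (ha : ∀ k, 0 ≤ a k)
    (htr : ∀ k, IsTraceClass (a k)) :
    TG a ≤ ((n + 1 : ℝ) * (n + 2))⁻¹ * ∑ k : Fin (n + 1), carlemanWeight k * (trace (a k)).re := by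
  have hlim : Tendsto (fun p : ℝ => (((n + 1 : ℕ) : ℝ)⁻¹ *
      ∑ k : Fin (n + 1), (carlemanWeight k)⁻¹ ^ (1 / p)) ^ p *
        ∑ k : Fin (n + 1), (carlemanWeight k)⁻¹ ^ (1 / p) /
          (∑ j : Fin (n + 1), (carlemanWeight j)⁻¹ ^ (1 / p)) *
            (carlemanWeight k * (trace (a k)).re)) atTop
      (𝓝 ((n + 2 : ℝ)⁻¹ * ∑ k : Fin (n + 1), 1 / (∑ _j : Fin (n + 1), (1 : ℝ)) *
        (carlemanWeight k * (trace (a k)).re))) := by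
    have h1 : ∀ k : ℕ, Tendsto (fun p : ℝ => (carlemanWeight k)⁻¹ ^ (1 / p)) atTop (𝓝 1) := by
      intro k
      have h := ((Real.continuous_const_rpow (inv_pos.2 (carlemanWeight_pos k)).ne').tendsto 0).comp
        (tendsto_const_nhds.div_atTop tendsto_id : Tendsto (fun p : ℝ => 1 / p) atTop (𝓝 0))
      simpa [Function.comp_def] using h
    refine (tendsto_rpow_mean_carlemanWeight n).mul (tendsto_finsetSum _ fun k _ => ?_)
    refine Tendsto.mul_const _ ((h1 k).div (tendsto_finsetSum _ fun j _ => h1 j) ?_)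
    simp only [Finset.sum_const, Finset.card_univ, Fintype.card_fin, nsmul_eq_mul, mul_one]
    positivity
  have hle := le_of_tendsto_of_tendsto (tendsto_trace_powerMean n.succ_pos ha htr) hlim (by
    filter_upwards [eventually_ge_atTop 1] with p hp
    exact (isTraceClass_powerMean_and_trace_le n.succ_pos hp ha htr _ fun k => carlemanWeight_pos k).2)
  refine hle.trans_eq ?_
  rw [← Finset.mul_sum, ← mul_assoc]
  congr 1
  simp [mul_comm]

end TracialMean

theorem mainTheorem8 {H : Type*} [NormedAddCommGroup H] [InnerProductSpace ℂ H] [CompleteSpace H]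
    (a : ℕ → H →L[ℂ] H) (ha : ∀ n, (a n).IsPositive)
    (htr : ∀ n, TracialMean.IsTraceClass (a n))
    (hsum : Summable fun n => (TracialMean.trace (a n)).re) :
    (∀ n : ℕ, ∀ p : ℝ, 1 ≤ p →
        TracialMean.IsTraceClass (TracialMean.powerMean p fun k : Fin (n + 1) => a k)) ∧
      (∀ n : ℕ, Tendsto
        (fun p : ℝ => (TracialMean.trace (TracialMean.powerMean p fun k : Fin (n + 1) => a k)).re)
        atTop (𝓝 (TracialMean.TG fun k : Fin (n + 1) => a k))) ∧
      (Summable fun n : ℕ => TracialMean.TG fun k : Fin (n + 1) => a k) ∧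
      ∑' n : ℕ, TracialMean.TG (fun k : Fin (n + 1) => a k) ≤
        Real.exp 1 * ∑' n : ℕ, (TracialMean.trace (a n)).re := by
  have ha' : ∀ n, 0 ≤ a n := fun n => (ContinuousLinearMap.nonneg_iff_isPositive _).2 (ha n)
  have hTG0 : ∀ n : ℕ, 0 ≤ TracialMean.TG fun k : Fin (n + 1) => a k := fun n =>
    TracialMean.TG_nonneg n.succ_pos (fun k => ha' k) fun k => htr k
  have hpartial : ∀ N, ∑ n ∈ Finset.range N, TracialMean.TG (fun k : Fin (n + 1) => a k) ≤
      Real.exp 1 * ∑' n : ℕ, (TracialMean.trace (a n)).re := fun N => by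
    refine le_trans (Finset.sum_le_sum fun n _ => ?_)
      (TracialMean.sum_range_mean_carlemanWeight_le (fun k => (TracialMean.trace (a k)).re)
        (fun k => TracialMean.trace_nonneg (ha' k) (htr k)) hsum N)
    rw [← Fin.sum_univ_eq_sum_range
      (fun k => TracialMean.carlemanWeight k * (TracialMean.trace (a k)).re)]
    exact TracialMean.TG_le (fun k => ha' k) fun k => htr k
  exact ⟨fun n p hp => (TracialMean.isTraceClass_powerMean_and_trace_le n.succ_pos hp (fun k => ha' k)
      (fun k => htr k) (fun _ => 1) fun _ => one_pos).1,
    fun n => TracialMean.tendsto_trace_powerMean n.succ_pos (fun k => ha' k) fun k => htr k,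
    summable_of_sum_range_le hTG0 hpartial, Real.tsum_le_of_sum_range_le hTG0 hpartial⟩
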